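/- Let $n\ge 1$. For a measurable function $f:\mathbb R^n\to\mathbb C$ write $\|f\|$ for its $L^2(\mathbb R^n)$-norm and $\|f\|_{1,1}=\int_{\mathbb R^n}(1+|x|)|f(x)|\,dx$; let $L^{1,1}(\mathbb R^n)$ be the space of $f\in L^1(\mathbb R^n)$ with $\|f\|_{1,1}<\infty$. For $t>0$ let $G(t,x)=(4\pi t)^{-n/2}e^{-|x|^2/(4t)}$ be the Gauss kernel. There is a constant $C>0$ depending only on $n$ such that the following holds. Let $u_0\in H^1(\mathbb R^n)\cap L^{1,1}(\mathbb R^n)$ and $u_1\in L^2(\mathbb R^n)\cap L^{1,1}(\mathbb R^n)$ be complex-valued (in particular, real-valued functions are allowed), and let $u\in C([0,\infty);H^1(\mathbb R^n))\cap C^1([0,\infty);L^2(\mathbb R^n))$ be the weak solution of the Cauchy problem $$u_{tt}-\Delta u+u_t=0\ \text{ in }(0,\infty)\times\mathbb R^n,\qquad u(0,x)=u_0(x),\quad u_t(0,x)=u_1(x),$$ that is, $u(0)=u_0$, $u_t(0)=u_1$, and for every Schwartz function $\varphi$ on $\mathbb R^n$ and every $t>0$ $$\frac{d}{dt}\int_{\mathbb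 R^n}u_t\,\varphi\,dx+\int_{\mathbb R^n}\nabla u\cdot\nabla\varphi\,dx+\int_{\mathbb R^n}u_t\,\varphi\,dx=0 .$$ Then, with $P_{0j}=\int_{\mathbb R^n}u_j(x)\,dx$ for $j=0,1$, $$\|u(t,\cdot)-(P_{00}+P_{01})G(t,\cdot)\|\le C\,t^{-\frac n4-\frac12}\bigl(\|u_0\|_{1,1}+\|u_1\|_{1,1}+\|u_0\|+\|\nabla u_0\|+\|u_1\|\bigr)\qquad\text{for all }t>0 .$$ -/

import Mathlib

open MeasureTheory Set
open scoped SchwartzMap ENNReal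

noncomputable section

namespace DampedWave

/-- The Euclidean space `ℝⁿ`. -/
abbrev Space (n : ℕ) : Type := EuclideanSpace ℝ (Fin n)

/-- `L²(ℝⁿ)`, complex valued. -/
abbrev L2 (n : ℕ) : Type := Lp ℂ 2 (volume : Measure (Space n))

/-- `L²(ℝⁿ; ℂⁿ)`, with the Euclidean norm on `ℂⁿ`. -/
abbrev L2Vec (n : ℕ) : Type :=
  Lp (EuclideanSpace ℂ (Fin n)) 2 (volume : Measure (Space n))

/-- The partial derivative `∂φ/∂xⱼ` of a test function. -/
def partialDeriv {n : ℕ} (j : Fin n) (φ : 𝓢(Space n, ℂ)) (x : Space n) : ℂ :=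
  fderiv ℝ φ x (EuclideanSpace.single j 1)

/-- `g` is the gradient of `f` in the sense of (tempered) distributions. -/
def IsWeakGradient {n : ℕ} (f : L2 n) (g : L2Vec n) : Prop :=
  ∀ (j : Fin n) (φ : 𝓢(Space n, ℂ)),
    ∫ x, f x * partialDeriv j φ x = -∫ x, g x j * φ x

/-- The Sobolev space `H¹(ℝⁿ)`: an `L²` function together with its (unique) weak gradient,
which is required to lie in `L²`. The topology is that of `L² × L²`, i.e. the one of the
`H¹` norm: `uₖ → u` iff `uₖ → u` and `∇uₖ → ∇u` in `L²`. -/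
abbrev H1 (n : ℕ) : Type := {p : L2 n × L2Vec n // IsWeakGradient p.1 p.2}

/-- The underlying `L²` function of an element of `H¹`. -/
def H1.toL2 {n : ℕ} (u : H1 n) : L2 n := u.1.1

/-- The weak gradient of an element of `H¹`. -/
def H1.grad {n : ℕ} (u : H1 n) : L2Vec n := u.1.2

/-- Membership in the weighted space `L^{1,k}(ℝⁿ)`. -/
def MemWeightedL1 {n : ℕ} (k : ℕ) (f : Space n → ℂ) : Prop :=
  Integrable f ∧ Integrable (fun x => (1 + ‖x‖) ^ k * ‖f x‖)

/-- The norm `‖f‖_{1,k} = ∫ (1 + |x|)^k |f(x)| dx`. -/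
def weightedL1Norm {n : ℕ} (k : ℕ) (f : Space n → ℂ) : ℝ :=
  ∫ x, (1 + ‖x‖) ^ k * ‖f x‖

/-- The Gauss kernel `G(t,x) = (4πt)^{-n/2} exp(-|x|²/(4t))`. -/
def gaussKernel {n : ℕ} (t : ℝ) (x : Space n) : ℝ :=
  1 / (Real.sqrt (4 * Real.pi * t)) ^ n * Real.exp (-‖x‖ ^ 2 / (4 * t))

/-- `u` is a weak solution on `[0,∞) × ℝⁿ`, in the class
`C([0,∞); H¹) ∩ C¹([0,∞); L²)`, of
`u_tt - Δu + u_t = 0`, `u(0) = u₀`, `u_t(0) = u₁`.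
Here `v` is the time derivative `u_t`, and the equation reads
`d/dt ⟨u_t, φ⟩ + ⟨∇u, ∇φ⟩ + ⟨u_t, φ⟩ = 0` for `t > 0` and every test function `φ` on `ℝⁿ`.
Values of `u` at negative times play no role. -/
def IsWeakSolution {n : ℕ} (u₀ : H1 n) (u₁ : L2 n) (u : ℝ → H1 n) : Prop :=
  ContinuousOn u (Ici 0) ∧ u 0 = u₀ ∧
  ∃ v : ℝ → L2 n,
    ContinuousOn v (Ici 0) ∧
    (∀ t ∈ Ici (0 : ℝ), HasDerivWithinAt (fun s => (u s).toL2) (v t) (Ici 0) t) ∧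
    v 0 = u₁ ∧
    ∀ φ : 𝓢(Space n, ℂ), ∀ t : ℝ, 0 < t →
      HasDerivAt (fun s => ∫ x, v s x * φ x)
        (-(∫ x, ∑ j : Fin n, (u t).grad x j * partialDeriv j φ x) - ∫ x, v t x * φ x) t

end DampedWave

end

/-!
On the Fourier side the equation is the damped oscillator `w'' + w' + a w = 0` with
`a = (2π|ξ|)²`. For `a ≤ 3/16` it factors as `(∂ₜ + 1 - ρ)(∂ₜ + ρ) w = 0`, where `ρ (1 - ρ) = a`
and `ρ ≤ 1/4`. The fast mode decays exponentially; the slow mode `e^{-ρt}` differs from `e^{-at}`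
by `O(ρ²t e^{-at})`, and its amplitude is `û₀ + û₁` up to `O(ρ)`. At `ξ` this amplitude differs from
its value `P₀₀ + P₀₁` at `ξ = 0` by at most `2π|ξ|` times the weighted norms, so the error is
controlled by `(1 + ta) √a e^{-at} ≲ t^{-1/2} e^{-at/4}`, whose `L²` norm is of order
`t^{-n/4 - 1/2}`. For `a ≥ 3/16` the energy of the oscillator, perturbed by a small cross term,
decays exponentially uniformly in `a`.

Almost everywhere statements in `ξ` are obtained by restricting to a bounded open set of
frequencies: testing against functions supported there turns the weak equation into an ordinary
differential equation in `L²` whose generator is a bounded multiplication operator.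
-/

noncomputable section

namespace DampedWave

open InnerProductSpace
open scoped FourierTransform Laplacian ContDiff

section Multiplication

variable {α F : Type*} [MeasurableSpace α] {μ : Measure α} [NormedAddCommGroup F] [NormedSpace ℝ F]
  {p : ℝ≥0∞} [Fact (1 ≤ p)] {m : α → ℝ}

/-- Multiplication by an essentially bounded function, as an operator on `Lᵖ`. -/
def mulOp (hm : MemLp m ∞ μ) : Lp F p μ →L[ℝ] Lp F p μ :=
  (ContinuousLinearMap.lsmul ℝ ℝ).holderL μ ∞ p p hm.toLp

lemma coeFn_mulOp (hm : MemLp m ∞ μ) (f : Lp F p μ) : mulOp hm f =ᵐ[μ] fun x => m x • f x := by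
  filter_upwards [(ContinuousLinearMap.lsmul ℝ ℝ).coeFn_holder (r := p) hm.toLp f, hm.coeFn_toLp]
    with x hx hmx
  rw [← hmx]
  exact hx

lemma coeFn_mulOp_pow (hm : MemLp m ∞ μ) (f : Lp F p μ) (k : ℕ) :
    (mulOp hm ^ k) f =ᵐ[μ] fun x => m x ^ k • f x := by
  induction k with
  | zero => simp
  | succ k ih =>
    rw [pow_succ']
    filter_upwards [coeFn_mulOp hm ((mulOp hm ^ k) f), ih] with x hx hk
    rw [mul_apply_eq_comp, hx, hk, smul_smul, pow_succ']

lemma coeFn_exp_smul_mulOp [CompleteSpace F] (hm : MemLp m ∞ μ) (c : ℝ) (f : Lp F p μ) :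
    NormedSpace.exp (c • (mulOp hm : Lp F p μ →L[ℝ] Lp F p μ)) f =ᵐ[μ]
      fun x => Real.exp (c * m x) • f x := by
  set T : Lp F p μ →L[ℝ] Lp F p μ := c • mulOp hm
  have hsum : NormedSpace.exp T f = ∑' k : ℕ, ((k.factorial : ℝ)⁻¹ • T ^ k) f :=
    ((NormedSpace.exp_series_hasSum_exp' (𝕂 := ℝ) T).mapL
      (ContinuousLinearMap.apply ℝ (Lp F p μ) f)).tsum_eq.symm
  have hnorm : Summable fun k : ℕ => ‖((k.factorial : ℝ)⁻¹ • T ^ k) f‖ :=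
    ((NormedSpace.norm_expSeries_summable' (𝕂 := ℝ) T).mul_right ‖f‖).of_nonneg_of_le
      (fun k => norm_nonneg _) fun k => ContinuousLinearMap.le_opNorm _ f
  have hterm (k : ℕ) : ((k.factorial : ℝ)⁻¹ • T ^ k) f =ᵐ[μ]
      fun x => ((k.factorial : ℝ)⁻¹ • (c * m x) ^ k) • f x := by
    rw [smul_pow, smul_smul, smul_apply]
    filter_upwards [Lp.coeFn_smul ((k.factorial : ℝ)⁻¹ * c ^ k) ((mulOp hm ^ k) f),
      coeFn_mulOp_pow hm f k] with x hsmul hpow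
    rw [hsmul, Pi.smul_apply, hpow, smul_smul, mul_pow, smul_eq_mul, mul_assoc]
  rw [hsum]
  filter_upwards [Lp.hasSum_coeFn_tsum (tsum_enorm_ne_top_iff_summable_norm.2 hnorm),
    ae_all_iff.2 hterm] with x hx hk
  simp only [hk] at hx
  have hexp := NormedSpace.exp_series_hasSum_exp' (𝕂 := ℝ) (c * m x)
  rw [← Real.exp_eq_exp_ℝ] at hexp
  exact hx.unique (hexp.smul_const (f x))

lemma norm_mulOp_apply_le (hm : MemLp m ∞ μ) {K : ℝ}
    (hK : ∀ᵐ x ∂μ, |m x| ≤ K) (f : Lp F p μ) : ‖mulOp hm f‖ ≤ K * ‖f‖ := by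
  refine Lp.norm_le_mul_norm_of_ae_le_mul ?_
  filter_upwards [coeFn_mulOp hm f, hK] with x hf hx
  rw [hf, norm_smul]
  exact mul_le_mul_of_nonneg_right hx (norm_nonneg _)

lemma mulOp_mul_mulOp {k q : α → ℝ} (hm : MemLp m ∞ μ) (hk : MemLp k ∞ μ) (hq : MemLp q ∞ μ)
    (h : ∀ᵐ x ∂μ, m x * k x = q x) :
    (mulOp hm * mulOp hk : Lp F p μ →L[ℝ] Lp F p μ) = mulOp hq := by
  ext1 f
  refine Lp.ext ?_
  filter_upwards [coeFn_mulOp hm (mulOp hk f), coeFn_mulOp hk f, coeFn_mulOp hq f, h]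
    with x hmx hkx hqx hx
  rw [mul_apply_eq_comp, hmx, hkx, hqx, smul_smul, hx]

lemma mulOp_eq_one (hm : MemLp m ∞ μ) (h : ∀ᵐ x ∂μ, m x = 1) :
    (mulOp hm : Lp F p μ →L[ℝ] Lp F p μ) = 1 := by
  ext1 f
  refine Lp.ext ?_
  filter_upwards [coeFn_mulOp hm f, h] with x hmx hx
  rw [hmx, hx, one_smul, one_apply_eq_self]

lemma mulOp_add_mulOp {k : α → ℝ} (hm : MemLp m ∞ μ) (hk : MemLp k ∞ μ) :
    (mulOp hm + mulOp hk : Lp F p μ →L[ℝ] Lp F p μ) = mulOp (hm.add hk) := by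
  rw [mulOp, mulOp, mulOp, MemLp.toLp_add, map_add]

end Multiplication

lemma isPositive_mulOp {α F : Type*} [MeasurableSpace α] {μ : Measure α} [NormedAddCommGroup F]
    [InnerProductSpace ℝ F] {m : α → ℝ} (hm : MemLp m ∞ μ) (h : ∀ᵐ x ∂μ, 0 ≤ m x) :
    (mulOp hm : Lp F 2 μ →L[ℝ] Lp F 2 μ).IsPositive := by
  refine ⟨fun f g => ?_, fun f => ?_⟩
  · rw [L2.inner_def, L2.inner_def]
    refine integral_congr_ae ?_
    filter_upwards [coeFn_mulOp hm f, coeFn_mulOp hm g] with x hf hg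
    simp only [ContinuousLinearMap.coe_coe, hf, hg, real_inner_smul_left, real_inner_smul_right]
  · rw [ContinuousLinearMap.reApplyInnerSelf_apply, L2.inner_def]
    refine integral_nonneg_of_ae ?_
    filter_upwards [coeFn_mulOp hm f, h] with x hf hx
    rw [hf, real_inner_smul_left]
    exact mul_nonneg hx real_inner_self_nonneg

section LinearODE

variable {E : Type*} [NormedAddCommGroup E] [NormedSpace ℝ E]

lemma eq_exp_smul_of_hasDerivWithinAt [CompleteSpace E] {A : E →L[ℝ] E} {w : ℝ → E}
    (hw : ∀ t, 0 ≤ t → HasDerivWithinAt w (A (w t)) (Ici 0) t) {t : ℝ} (ht : 0 ≤ t) :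
    w t = NormedSpace.exp (t • A) (w 0) := by
  have hexp (s : ℝ) : HasDerivAt (fun s : ℝ => NormedSpace.exp (s • A) (w 0))
      (A (NormedSpace.exp (s • A) (w 0))) s := by
    simpa using (hasDerivAt_exp_smul_const' A s).clm_apply (hasDerivAt_const s (w 0))
  refine ODE_solution_unique (v := fun _ => A) (a := 0) (b := t) (K := ‖A‖₊)
    (fun _ => A.lipschitz)
    (fun s hs => (hw s hs.1).continuousWithinAt.mono Icc_subset_Ici_self)
    (fun s hs => (hw s hs.1).mono (Ici_subset_Ici.2 hs.1))
    (fun s _ => (hexp s).continuousAt.continuousWithinAt)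
    (fun s _ => (hexp s).hasDerivWithinAt) (by simp) ⟨ht, le_rfl⟩

lemma le_exp_mul_of_hasDerivWithinAt_le {e e' : ℝ → ℝ} {k : ℝ}
    (he : ∀ t, 0 ≤ t → HasDerivWithinAt e (e' t) (Ici 0) t)
    (hle : ∀ t, 0 ≤ t → e' t ≤ -k * e t) {t : ℝ} (ht : 0 ≤ t) :
    e t ≤ Real.exp (-k * t) * e 0 := by
  have := le_gronwallBound_of_liminf_deriv_right_le (f := e) (f' := e') (δ := e 0) (K := -k)
    (ε := 0) (a := 0) (b := t)
    (fun s hs => (he s hs.1).continuousWithinAt.mono Icc_subset_Ici_self)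
    (fun s hs r hr => ((he s hs.1).mono (Ici_subset_Ici.2 hs.1)).liminf_right_slope_le hr)
    le_rfl (fun s hs => by simpa using hle s hs.1) t ⟨ht, le_rfl⟩
  rwa [gronwallBound_ε0, sub_zero, mul_comm] at this

lemma hasDerivWithinAt_of_separating [CompleteSpace E] {G ι : Type*} [NormedAddCommGroup G]
    [NormedSpace ℝ G] [CompleteSpace G] {ℓ : ι → E →L[ℝ] G} (hℓ : ∀ x, (∀ i, ℓ i x = 0) → x = 0)
    {W Y : ℝ → E} (hW : ContinuousOn W (Ici 0)) (hY : ContinuousOn Y (Ici 0))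
    (hder : ∀ i t, 0 < t → HasDerivAt (fun s => ℓ i (W s)) (ℓ i (Y t)) t) {t : ℝ} (ht : 0 ≤ t) :
    HasDerivWithinAt W (Y t) (Ici 0) t := by
  -- `Y` is extended to negative times by `Y 0`, so that its primitive is differentiable at `0`.
  set Z : ℝ → E := fun s => Y (max s 0)
  have hZ : Continuous Z :=
    hY.comp_continuous (continuous_id.max continuous_const) fun s => le_max_right s 0
  have hZY {s : ℝ} (hs : 0 ≤ s) : Z s = Y s := by simp only [Z, max_eq_left hs]
  have hprim (s : ℝ) : HasDerivAt (fun s => W 0 + ∫ r in (0 : ℝ)..s, Z r) (Z s) s :=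
    (hZ.integral_hasStrictDerivAt 0 s).hasDerivAt.const_add (W 0)
  have hWZ {s : ℝ} (hs : 0 ≤ s) : W s = W 0 + ∫ r in (0 : ℝ)..s, Z r := by
    refine sub_eq_zero.1 (hℓ _ fun i => ?_)
    have hftc : ∫ r in (0 : ℝ)..s, ℓ i (Z r) = ℓ i (W s) - ℓ i (W 0) :=
      intervalIntegral.integral_eq_sub_of_hasDerivAt_of_le hs
        (((ℓ i).continuous.comp_continuousOn hW).mono Icc_subset_Ici_self)
        (fun r hr => (hZY hr.1.le).symm ▸ hder i r hr.1)
        (((ℓ i).continuous.comp hZ).intervalIntegrable 0 s)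
    rw [map_sub, map_add, ← (ℓ i).intervalIntegral_comp_comm (hZ.intervalIntegrable 0 s), hftc]
    abel
  rw [← hZY ht]
  exact (hprim t).hasDerivWithinAt.congr (fun s hs => hWZ hs) (hWZ ht)

end LinearODE

section DampedOscillator

variable {E : Type*} [NormedAddCommGroup E]

/-- `U` is a solution of `U'' + U' + S U = 0` on `[0, ∞)`, written as a first order system with
`V = U'`. -/
structure IsDampedOscillator [NormedSpace ℝ E] (S : E →L[ℝ] E) (U V : ℝ → E) : Prop where
  hasDerivWithinAt_fst : ∀ t, 0 ≤ t → HasDerivWithinAt U (V t) (Ici 0) t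
  hasDerivWithinAt_snd : ∀ t, 0 ≤ t → HasDerivWithinAt V (-S (U t) - V t) (Ici 0) t

-- `∂ₜ² + ∂ₜ + S = (∂ₜ + R₂)(∂ₜ + R₁)`.
lemma IsDampedOscillator.eq_exp_of_factorization [NormedSpace ℝ E] [CompleteSpace E]
    {S R₁ R₂ : E →L[ℝ] E} {U V : ℝ → E} (h : IsDampedOscillator S U V) (hadd : R₁ + R₂ = 1)
    (hmul : R₂ * R₁ = S) {t : ℝ} (ht : 0 ≤ t) :
    V t + R₁ (U t) = NormedSpace.exp (-t • R₂) (V 0 + R₁ (U 0)) := by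
  rw [neg_smul, ← smul_neg]
  refine eq_exp_smul_of_hasDerivWithinAt (w := fun s => V s + R₁ (U s)) (fun s hs => ?_) ht
  refine ((h.hasDerivWithinAt_snd s hs).add
    (R₁.hasFDerivAt.comp_hasDerivWithinAt s (h.hasDerivWithinAt_fst s hs))).congr_deriv ?_
  have hV : R₁ (V s) = V s - R₂ (V s) := by
    rw [eq_sub_iff_add_eq, ← add_apply, hadd, one_apply_eq_self]
  rw [← hmul, mul_apply_eq_comp, neg_apply, map_add, hV]
  abel

variable [InnerProductSpace ℝ E]

lemma two_mul_abs_inner_le_of_isPositive {P : E →L[ℝ] E} (hP : P.IsPositive) {M : ℝ}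
    (hM : ∀ x, ⟪P x, x⟫_ℝ ≤ M * ‖x‖ ^ 2) (x y : E) (l : ℝ) :
    |2 * l * ⟪P x, y⟫_ℝ| ≤ M * l ^ 2 * ‖x‖ ^ 2 + ⟪P y, y⟫_ℝ := by
  have hsymm : ⟪P y, x⟫_ℝ = ⟪P x, y⟫_ℝ :=
    (hP.isSymmetric y x).trans (real_inner_comm _ _)
  have hpos (c : ℝ) : 0 ≤ c ^ 2 * ⟪P x, x⟫_ℝ + 2 * c * ⟪P x, y⟫_ℝ + ⟪P y, y⟫_ℝ := by
    have := hP.inner_nonneg_left (c • x + y)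
    simp only [map_add, map_smul, inner_add_left, inner_add_right, real_inner_smul_left,
      real_inner_smul_right, hsymm] at this
    linarith
  have hx := mul_le_mul_of_nonneg_left (hM x) (sq_nonneg l)
  rw [abs_le]
  constructor <;> linarith [hpos l, hpos (-l), neg_sq l]

/-- The energy of the damped oscillator `U'' + U' + S U = 0`, with `P` the inverse of `S`. The
cross term makes it a strict Lyapunov function. -/
def oscillatorEnergy (P : E →L[ℝ] E) (x y : E) : ℝ :=
  ⟪P y, y⟫_ℝ + ‖x‖ ^ 2 + 1 / 6 * ⟪P x, y⟫_ℝ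

/-- The derivative of `oscillatorEnergy` along `U'' + U' + S U = 0`. -/
def oscillatorDissipation (P : E →L[ℝ] E) (x y : E) : ℝ :=
  -2 * ⟪P y, y⟫_ℝ + 1 / 6 * (⟪P y, y⟫_ℝ - ‖x‖ ^ 2 - ⟪P x, y⟫_ℝ)

lemma IsDampedOscillator.hasDerivWithinAt_energy {S P : E →L[ℝ] E} {U V : ℝ → E}
    (h : IsDampedOscillator S U V) (hP : (P : E →ₗ[ℝ] E).IsSymmetric) (hPS : P * S = 1)
    {t : ℝ} (ht : 0 ≤ t) :
    HasDerivWithinAt (fun s => oscillatorEnergy P (U s) (V s))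
      (oscillatorDissipation P (U t) (V t)) (Ici 0) t := by
  have hU := h.hasDerivWithinAt_fst t ht
  have hV := h.hasDerivWithinAt_snd t ht
  have hPU := P.hasFDerivAt.comp_hasDerivWithinAt t hU
  have hPV := P.hasFDerivAt.comp_hasDerivWithinAt t hV
  have hcancel (x : E) : P (S x) = x := DFunLike.congr_fun hPS x
  have hswap (x y : E) : ⟪P x, S y⟫_ℝ = ⟪x, y⟫_ℝ :=
    (hP x (S y)).trans (congrArg _ (hcancel y))
  refine (((hPV.inner ℝ hV).add hU.norm_sq).add
    ((hPU.inner ℝ hV).const_mul (1 / 6))).congr_deriv ?_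
  simp only [oscillatorDissipation, map_sub, map_neg, hcancel, inner_sub_left, inner_sub_right,
    inner_neg_left, inner_neg_right, Function.comp_apply, hswap, real_inner_comm (U t) (V t),
    real_inner_self_eq_norm_sq]
  ring

lemma abs_oscillatorEnergy_crossTerm_le {P : E →L[ℝ] E} (hP : P.IsPositive)
    (hM : ∀ x, ⟪P x, x⟫_ℝ ≤ 8 * ‖x‖ ^ 2) (x y : E) :
    |1 / 6 * ⟪P x, y⟫_ℝ| ≤ 1 / 4 * (‖x‖ ^ 2 + ⟪P y, y⟫_ℝ) := by
  have h := two_mul_abs_inner_le_of_isPositive hP hM x y (1 / 3)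
  have hy := hP.inner_nonneg_left y
  rw [abs_le] at h ⊢
  constructor <;> nlinarith [sq_nonneg ‖x‖]

lemma oscillatorDissipation_le {P : E →L[ℝ] E} (hP : P.IsPositive)
    (hM : ∀ x, ⟪P x, x⟫_ℝ ≤ 8 * ‖x‖ ^ 2) (x y : E) :
    oscillatorDissipation P x y ≤ -(1 / 15) * oscillatorEnergy P x y := by
  have h := neg_le_of_abs_le (two_mul_abs_inner_le_of_isPositive hP hM x y (1 / 8))
  have hy := hP.inner_nonneg_left y
  unfold oscillatorDissipation oscillatorEnergy
  nlinarith [sq_nonneg ‖x‖]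

lemma IsDampedOscillator.norm_le {S P : E →L[ℝ] E} {U V : ℝ → E} (h : IsDampedOscillator S U V)
    (hP : P.IsPositive) (hPS : P * S = 1) (hM : ∀ x, ⟪P x, x⟫_ℝ ≤ 8 * ‖x‖ ^ 2) {t : ℝ}
    (ht : 0 ≤ t) : ‖U t‖ ≤ 4 * Real.exp (-(t / 30)) * (‖U 0‖ + ‖V 0‖) := by
  set e : ℝ → ℝ := fun s => oscillatorEnergy P (U s) (V s)
  have hdecay : e t ≤ Real.exp (-(1 / 15) * t) * e 0 :=
    le_exp_mul_of_hasDerivWithinAt_le (fun s hs => h.hasDerivWithinAt_energy hP.isSymmetric hPS hs)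
      (fun s _ => oscillatorDissipation_le hP hM (U s) (V s)) ht
  have hlow : 3 / 4 * ‖U t‖ ^ 2 ≤ e t := by
    have := neg_le_of_abs_le (abs_oscillatorEnergy_crossTerm_le hP hM (U t) (V t))
    have := hP.inner_nonneg_left (V t)
    simp only [e, oscillatorEnergy]
    linarith
  have hup : e 0 ≤ 12 * (‖U 0‖ + ‖V 0‖) ^ 2 := by
    have := le_of_abs_le (abs_oscillatorEnergy_crossTerm_le hP hM (U 0) (V 0))
    have := hM (V 0)
    have := mul_nonneg (norm_nonneg (U 0)) (norm_nonneg (V 0))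
    simp only [e, oscillatorEnergy]
    nlinarith [sq_nonneg ‖U 0‖, sq_nonneg ‖V 0‖]
  have hexp : Real.exp (-(1 / 15) * t) = Real.exp (-(t / 30)) ^ 2 := by
    rw [← Real.exp_nat_mul]
    congr 1
    push_cast
    ring
  rw [hexp] at hdecay
  refine (sq_le_sq₀ (norm_nonneg _) (by positivity)).1 ?_
  nlinarith [mul_le_mul_of_nonneg_left hup (sq_nonneg (Real.exp (-(t / 30))))]

end DampedOscillator

section MultiplicationOscillator

variable {α F : Type*} [MeasurableSpace α] {μ : Measure α} [NormedAddCommGroup F] {σ : α → ℝ}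

lemma ae_eq_exp_of_isDampedOscillator_mulOp [NormedSpace ℝ F] [CompleteSpace F] {p : ℝ≥0∞}
    [Fact (1 ≤ p)] {hσ : MemLp σ ∞ μ} {U V : ℝ → Lp F p μ}
    (h : IsDampedOscillator (mulOp hσ) U V) {r : α → ℝ} (hr : MemLp r ∞ μ)
    (hroot : ∀ᵐ x ∂μ, (1 - r x) * r x = σ x) {t : ℝ} (ht : 0 ≤ t) :
    ∀ᵐ x ∂μ, V t x + r x • U t x =
      Real.exp (-t * (1 - r x)) • (V 0 x + r x • U 0 x) := by
  have hr' : MemLp (fun x => 1 - r x) ∞ μ := (memLp_top_const 1).sub hr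
  have hadd : (mulOp hr + mulOp hr' : Lp F p μ →L[ℝ] Lp F p μ) = 1 := by
    rw [mulOp_add_mulOp]
    exact mulOp_eq_one _ (ae_of_all _ fun x => by simp)
  have hsol := h.eq_exp_of_factorization hadd (mulOp_mul_mulOp hr' hr hσ hroot) ht
  have hcoe (s : ℝ) : ∀ᵐ x ∂μ, (V s + mulOp hr (U s)) x = V s x + r x • U s x := by
    filter_upwards [Lp.coeFn_add (V s) (mulOp hr (U s)), coeFn_mulOp hr (U s)] with x hadd hmul
    rw [hadd, Pi.add_apply, hmul]
  filter_upwards [coeFn_exp_smul_mulOp hr' (-t) (V 0 + mulOp hr (U 0)), hcoe t, hcoe 0]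
    with x hexp hxt hx0
  rw [← hxt, ← hx0, hsol, hexp]

lemma norm_le_of_isDampedOscillator_mulOp [InnerProductSpace ℝ F] {hσ : MemLp σ ∞ μ}
    {U V : ℝ → Lp F 2 μ} (h : IsDampedOscillator (mulOp hσ) U V)
    (hlow : ∀ᵐ x ∂μ, 1 / 8 ≤ σ x) {t : ℝ} (ht : 0 ≤ t) :
    ‖U t‖ ≤ 4 * Real.exp (-(t / 30)) * (‖U 0‖ + ‖V 0‖) := by
  have hbound : ∀ᵐ x ∂μ, |(σ x)⁻¹| ≤ 8 := hlow.mono fun x hx => by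
    rw [abs_of_nonneg (by positivity), inv_le_comm₀ (by linarith) (by norm_num)]
    linarith
  have hinv : MemLp (fun x => (σ x)⁻¹) ∞ μ :=
    memLp_top_of_bound hσ.1.aemeasurable.inv.aestronglyMeasurable 8 hbound
  refine h.norm_le (P := mulOp hinv) (isPositive_mulOp hinv ?_) ?_ (fun f => ?_) ht
  · exact hlow.mono fun x hx => inv_nonneg.2 (by linarith)
  · rw [mulOp_mul_mulOp hinv hσ (memLp_top_const 1)
      (hlow.mono fun x hx => inv_mul_cancel₀ (by linarith))]
    exact mulOp_eq_one _ (ae_of_all _ fun _ => rfl)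
  · calc ⟪mulOp hinv f, f⟫_ℝ ≤ ‖mulOp hinv f‖ * ‖f‖ := real_inner_le_norm _ _
      _ ≤ 8 * ‖f‖ * ‖f‖ := by gcongr; exact norm_mulOp_apply_le hinv hbound f
      _ = 8 * ‖f‖ ^ 2 := by ring

end MultiplicationOscillator

section Fourier

variable {E : Type*} [NormedAddCommGroup E]

/-- The Fourier symbol of `-Δ`. -/
def laplaceSymbol (ξ : E) : ℝ := (2 * Real.pi) ^ 2 * ‖ξ‖ ^ 2

lemma laplaceSymbol_nonneg (ξ : E) : 0 ≤ laplaceSymbol ξ := by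
  unfold laplaceSymbol
  positivity

lemma continuous_laplaceSymbol : Continuous (laplaceSymbol : E → ℝ) := by
  unfold laplaceSymbol
  fun_prop

lemma laplaceSymbol_eq_sq (ξ : E) : laplaceSymbol ξ = (2 * Real.pi * ‖ξ‖) ^ 2 :=
  (mul_pow _ _ _).symm

variable [InnerProductSpace ℝ E]

lemma exists_schwartzMap_eq {g : E → ℝ} (hg : ContDiff ℝ ∞ g) (hgc : HasCompactSupport g) :
    ∃ ψ : 𝓢(E, ℂ), ∀ x, ψ x = g x :=
  ⟨HasCompactSupport.toSchwartzMap (f := fun x => (g x : ℂ))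
    (hgc.comp_left (g := Complex.ofReal) rfl) (Complex.ofRealCLM.contDiff.comp hg), fun _ => rfl⟩

variable [FiniteDimensional ℝ E] [MeasurableSpace E] [BorelSpace E]

lemma integral_mul_eq_toTemperedDistribution (f : Lp ℂ 2 (volume : Measure E)) (ψ : 𝓢(E, ℂ)) :
    ∫ x, f x * ψ x = Lp.toTemperedDistribution f ψ := by
  simp only [Lp.toTemperedDistribution_apply, smul_eq_mul, mul_comm]

lemma integral_fourier_mul (f : Lp ℂ 2 (volume : Measure E)) (ψ : 𝓢(E, ℂ)) :
    ∫ ξ, 𝓕 f ξ * ψ ξ = ∫ x, f x * 𝓕 ψ x := by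
  rw [integral_mul_eq_toTemperedDistribution, integral_mul_eq_toTemperedDistribution,
    ← Lp.fourier_toTemperedDistribution_eq, TemperedDistribution.fourier_apply]

lemma integral_mul_laplacian_fourier (f : Lp ℂ 2 (volume : Measure E)) (ψ : 𝓢(E, ℂ)) :
    ∫ x, f x * (Δ (𝓕 ψ)) x = -∫ ξ, laplaceSymbol ξ • 𝓕 f ξ * ψ ξ := by
  have hgrowth : Function.HasTemperateGrowth fun ξ : E => Complex.ofReal (‖ξ‖ ^ 2) := by
    fun_prop
  have key : ∫ x, f x * (Δ (𝓕 ψ)) x = -(2 * Real.pi) ^ 2 *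
      ∫ ξ, 𝓕 f ξ * SchwartzMap.smulLeftCLM ℂ (fun ξ : E => Complex.ofReal (‖ξ‖ ^ 2)) ψ ξ := by
    rw [integral_mul_eq_toTemperedDistribution, integral_mul_eq_toTemperedDistribution,
      ← TemperedDistribution.laplacian_apply_apply,
      TemperedDistribution.laplacian_eq_fourierMultiplierCLM,
      ← Lp.fourier_toTemperedDistribution_eq, TemperedDistribution.fourier_apply]
    change -(2 * Real.pi) ^ 2 • TemperedDistribution.fourierMultiplierCLM ℂ _ _ (𝓕 ψ) = _
    rw [TemperedDistribution.fourierMultiplierCLM_apply_apply,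
      FourierTransform.fourierInv_fourier_eq]
    simp only [Complex.real_smul, Complex.ofReal_neg, Complex.ofReal_pow, Complex.ofReal_mul,
      Complex.ofReal_ofNat]
  rw [key, neg_mul, ← integral_const_mul]
  congr 2
  ext ξ
  rw [SchwartzMap.smulLeftCLM_apply_apply hgrowth]
  simp only [laplaceSymbol, smul_eq_mul, Complex.real_smul]
  push_cast
  ring

lemma coeFn_fourier_of_integrable {f : Lp ℂ 2 (volume : Measure E)} (hf : Integrable f) :
    (𝓕 f : Lp ℂ 2 (volume : Measure E)) =ᵐ[volume] 𝓕 (f : E → ℂ) := by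
  have hcont : Continuous (𝓕 (f : E → ℂ)) := VectorFourier.fourierIntegral_continuous
    Real.continuous_fourierChar (by exact continuous_inner) hf
  refine ae_eq_of_integral_contDiff_smul_eq
    ((Lp.memLp (𝓕 f : Lp ℂ 2 (volume : Measure E))).locallyIntegrable one_le_two)
    hcont.locallyIntegrable fun g hg hgc => ?_
  obtain ⟨ψ, hψ⟩ := exists_schwartzMap_eq hg hgc
  calc ∫ ξ, g ξ • 𝓕 f ξ = ∫ ξ, 𝓕 f ξ * ψ ξ := by simp only [hψ, Complex.real_smul, mul_comm]
    _ = ∫ x, f x * 𝓕 (ψ : E → ℂ) x := by rw [integral_fourier_mul, SchwartzMap.fourier_coe]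
    _ = ∫ ξ, 𝓕 (f : E → ℂ) ξ * ψ ξ := by
      simpa only [smul_eq_mul, flip_innerₗ] using!
        (VectorFourier.integral_fourierIntegral_smul_eq_flip (L := innerₗ E) (μ := volume)
          (ν := volume) Real.continuous_fourierChar (by exact continuous_inner) hf
          ψ.integrable).symm
    _ = ∫ ξ, g ξ • 𝓕 (f : E → ℂ) ξ := by simp only [hψ, Complex.real_smul, mul_comm]

lemma norm_fourier_sub_integral_le {f : E → ℂ} (hf : Integrable f)
    (hxf : Integrable fun x => ‖x‖ * ‖f x‖) (ξ : E) :
    ‖𝓕 f ξ - ∫ x, f x‖ ≤ 2 * Real.pi * ‖ξ‖ * ∫ x, ‖x‖ * ‖f x‖ := by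
  have hintegrable : Integrable fun x => Real.fourierChar (-⟪x, ξ⟫_ℝ) • f x := by
    simpa using (Real.fourierIntegral_convergent_iff (μ := volume) (f := f) ξ).2 hf
  rw [Real.fourier_eq, ← integral_sub hintegrable hf, ← integral_const_mul]
  refine norm_integral_le_of_norm_le (hxf.const_mul _) (ae_of_all _ fun x => ?_)
  have hchar : ‖(Real.fourierChar (-⟪x, ξ⟫_ℝ) : ℂ) - 1‖ ≤ 2 * Real.pi * (‖x‖ * ‖ξ‖) := by
    rw [Real.fourierChar_apply, mul_comm _ Complex.I]
    refine Real.norm_exp_I_mul_ofReal_sub_one_le.trans ?_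
    rw [norm_mul, norm_neg, Real.norm_of_nonneg (by positivity)]
    gcongr
    exact norm_inner_le_norm x ξ
  calc ‖Real.fourierChar (-⟪x, ξ⟫_ℝ) • f x - f x‖
      = ‖(Real.fourierChar (-⟪x, ξ⟫_ℝ) : ℂ) - 1‖ * ‖f x‖ := by
        rw [← norm_mul, sub_mul, one_mul, Circle.smul_def, smul_eq_mul]
    _ ≤ 2 * Real.pi * (‖x‖ * ‖ξ‖) * ‖f x‖ := by gcongr
    _ = 2 * Real.pi * ‖ξ‖ * (‖x‖ * ‖f x‖) := by ring

end Fourier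

/-- The integral against a square integrable function, as a functional on `L²`. -/
def integralSMul {α : Type*} [MeasurableSpace α] {μ : Measure α} {g : α → ℝ}
    (hg : MemLp g 2 μ) : Lp ℂ 2 μ →L[ℝ] ℂ :=
  (ContinuousLinearMap.lsmul ℝ ℝ).lpPairing μ 2 2 hg.toLp

lemma integralSMul_apply {α : Type*} [MeasurableSpace α] {μ : Measure α} {g : α → ℝ}
    (hg : MemLp g 2 μ) (f : Lp ℂ 2 μ) :
    integralSMul hg f = ∫ x, g x • f x ∂μ := by
  rw [integralSMul, ContinuousLinearMap.lpPairing_eq_integral]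
  refine integral_congr_ae ?_
  filter_upwards [hg.coeFn_toLp] with x hx
  rw [hx, ContinuousLinearMap.lsmul_apply]

section VeryWeakSolution

variable {E : Type*} [NormedAddCommGroup E] [InnerProductSpace ℝ E] [FiniteDimensional ℝ E]
  [MeasurableSpace E] [BorelSpace E]

/-- `u` is a very weak solution of `u_tt - Δu + u_t = 0` on `[0, ∞) × E` with time derivative
`v = u_t`: it is only required to lie in `C¹([0, ∞); L²)`, and the Laplacian is moved onto the test
function. -/
structure IsVeryWeakSolution (u v : ℝ → Lp ℂ 2 (volume : Measure E)) : Prop where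
  continuousOn_snd : ContinuousOn v (Ici 0)
  hasDerivWithinAt_fst : ∀ t, 0 ≤ t → HasDerivWithinAt u (v t) (Ici 0) t
  hasDerivAt_integral_mul : ∀ φ : 𝓢(E, ℂ), ∀ t, 0 < t →
    HasDerivAt (fun s => ∫ x, v s x * φ x) ((∫ x, u t x * (Δ φ) x) - ∫ x, v t x * φ x) t

/-- The restriction of the Fourier transform to a set of frequencies. -/
def fourierRestrict (S : Set E) :
    Lp ℂ 2 (volume : Measure E) →L[ℝ] Lp ℂ 2 (volume.restrict S : Measure E) :=
  (LpToLpRestrictCLM E ℂ ℝ volume 2 S).comp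
    ((FourierTransform.fourierCLM ℂ (Lp ℂ 2 (volume : Measure E))).restrictScalars ℝ)

lemma coeFn_fourierRestrict (S : Set E) (f : Lp ℂ 2 (volume : Measure E)) :
    fourierRestrict S f =ᵐ[volume.restrict S] (𝓕 f : Lp ℂ 2 (volume : Measure E)) :=
  LpToLpRestrictCLM_coeFn ℝ S _

lemma norm_fourierRestrict_le (S : Set E) (f : Lp ℂ 2 (volume : Measure E)) :
    ‖fourierRestrict S f‖ ≤ ‖f‖ := by
  rw [← Lp.norm_fourier_eq f, Lp.norm_def, Lp.norm_def,
    eLpNorm_congr_ae (coeFn_fourierRestrict S f)]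
  exact ENNReal.toReal_mono (Lp.eLpNorm_ne_top _) (eLpNorm_restrict_le _ _ _ _)

lemma Lp_restrict_eq_zero_of_integral_smul_eq_zero {S : Set E} (hS : IsOpen S)
    {f : Lp ℂ 2 (volume.restrict S : Measure E)}
    (h : ∀ g : E → ℝ, ContDiff ℝ ∞ g → HasCompactSupport g → tsupport g ⊆ S →
      ∫ x in S, g x • f x = 0) : f = 0 := by
  rw [Lp.eq_zero_iff_ae_eq_zero]
  have hloc := ((Lp.memLp f).locallyIntegrable one_le_two).locallyIntegrableOn S
  filter_upwards [hS.ae_eq_zero_of_integral_contDiff_smul_eq_zero hloc h,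
    ae_restrict_mem hS.measurableSet] with x hx hxS using hx hxS

lemma IsVeryWeakSolution.hasDerivAt_integral_fourier_mul {u v : ℝ → Lp ℂ 2 (volume : Measure E)}
    (h : IsVeryWeakSolution u v) (ψ : 𝓢(E, ℂ)) {t : ℝ} (ht : 0 < t) :
    HasDerivAt (fun s => ∫ ξ, 𝓕 (v s) ξ * ψ ξ)
      (-(∫ ξ, laplaceSymbol ξ • 𝓕 (u t) ξ * ψ ξ) - ∫ ξ, 𝓕 (v t) ξ * ψ ξ) t := by
  simpa only [integral_fourier_mul, integral_mul_laplacian_fourier] using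
    h.hasDerivAt_integral_mul (𝓕 ψ) t ht

lemma setIntegral_smul_fourierRestrict {S : Set E} {g : E → ℝ} (hgS : tsupport g ⊆ S)
    (f : Lp ℂ 2 (volume : Measure E)) :
    ∫ ξ in S, g ξ • fourierRestrict S f ξ = ∫ ξ, g ξ • 𝓕 f ξ := by
  have hcoe : ∫ ξ in S, g ξ • fourierRestrict S f ξ = ∫ ξ in S, g ξ • 𝓕 f ξ :=
    integral_congr_ae ((coeFn_fourierRestrict S f).mono fun ξ hξ => congrArg (g ξ • ·) hξ)
  rw [hcoe]
  refine setIntegral_eq_integral_of_forall_compl_eq_zero fun ξ hξ => ?_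
  rw [image_eq_zero_of_notMem_tsupport fun h => hξ (hgS h), zero_smul]

lemma integralSMul_fourierRestrict {S : Set E} {g : E → ℝ}
    (hg : MemLp g 2 (volume.restrict S : Measure E)) (hgS : tsupport g ⊆ S) {ψ : 𝓢(E, ℂ)}
    (hψ : ∀ ξ, ψ ξ = g ξ) (f : Lp ℂ 2 (volume : Measure E)) :
    integralSMul hg (fourierRestrict S f) = ∫ ξ, 𝓕 f ξ * ψ ξ := by
  rw [integralSMul_apply, setIntegral_smul_fourierRestrict hgS]
  simp only [hψ, Complex.real_smul, mul_comm]

lemma integralSMul_mulOp_fourierRestrict {S : Set E} {g σ : E → ℝ}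
    (hg : MemLp g 2 (volume.restrict S : Measure E)) (hgS : tsupport g ⊆ S) {ψ : 𝓢(E, ℂ)}
    (hψ : ∀ ξ, ψ ξ = g ξ) (hσ : MemLp σ ∞ (volume.restrict S : Measure E))
    (f : Lp ℂ 2 (volume : Measure E)) :
    integralSMul hg (mulOp hσ (fourierRestrict S f)) = ∫ ξ, σ ξ • 𝓕 f ξ * ψ ξ := by
  have hmul : ∫ ξ in S, g ξ • mulOp hσ (fourierRestrict S f) ξ =
      ∫ ξ in S, (g ξ * σ ξ) • fourierRestrict S f ξ := by
    refine integral_congr_ae ?_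
    filter_upwards [coeFn_mulOp hσ (fourierRestrict S f)] with ξ hξ
    rw [hξ, smul_smul]
  rw [integralSMul_apply, hmul,
    setIntegral_smul_fourierRestrict (tsupport_mul_subset_left.trans hgS)]
  refine integral_congr_ae (ae_of_all _ fun ξ => ?_)
  simp only [hψ, Complex.real_smul, Complex.ofReal_mul]
  ring

lemma IsVeryWeakSolution.isDampedOscillator {u v : ℝ → Lp ℂ 2 (volume : Measure E)}
    (h : IsVeryWeakSolution u v) {S : Set E} (hS : IsOpen S)
    (hσ : MemLp laplaceSymbol ∞ (volume.restrict S : Measure E)) :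
    IsDampedOscillator (mulOp hσ) (fun t => fourierRestrict S (u t))
      (fun t => fourierRestrict S (v t)) := by
  have hU (t : ℝ) (ht : 0 ≤ t) : HasDerivWithinAt (fun t => fourierRestrict S (u t))
      (fourierRestrict S (v t)) (Ici 0) t :=
    (fourierRestrict S).hasFDerivAt.comp_hasDerivWithinAt t (h.hasDerivWithinAt_fst t ht)
  have hV : ContinuousOn (fun t => fourierRestrict S (v t)) (Ici 0) :=
    (fourierRestrict S).continuous.comp_continuousOn h.continuousOn_snd
  have hmulU : ContinuousOn (fun t => mulOp hσ (fourierRestrict S (u t))) (Ici 0) :=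
    (mulOp hσ).continuous.comp_continuousOn fun t ht => (hU t ht).continuousWithinAt
  refine ⟨hU, fun t ht => ?_⟩
  let ι := {g : E → ℝ // ContDiff ℝ ∞ g ∧ HasCompactSupport g ∧ tsupport g ⊆ S}
  have hmem (g : ι) : MemLp g.1 2 (volume.restrict S : Measure E) :=
    g.2.1.continuous.memLp_of_hasCompactSupport g.2.2.1
  refine hasDerivWithinAt_of_separating
    (Y := fun s => -mulOp hσ (fourierRestrict S (u s)) - fourierRestrict S (v s))
    (ℓ := fun g : ι => integralSMul (hmem g)) (fun f hf => ?_) hV (hmulU.neg.sub hV)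
    (fun ⟨g, hg, hgc, hgS⟩ s hs => ?_) ht
  · exact Lp_restrict_eq_zero_of_integral_smul_eq_zero hS fun g hg hgc hgS =>
      (integralSMul_apply _ f).symm.trans (hf ⟨g, hg, hgc, hgS⟩)
  · obtain ⟨ψ, hψ⟩ := exists_schwartzMap_eq hg hgc
    simp only [map_sub, map_neg, integralSMul_fourierRestrict _ hgS hψ,
      integralSMul_mulOp_fourierRestrict _ hgS hψ]
    exact h.hasDerivAt_integral_fourier_mul ψ hs

end VeryWeakSolution

/-- The smaller root of `r (1 - r) = a`: the decay rate of the slow mode of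
`w'' + w' + a w = 0`. -/
def slowRoot (a : ℝ) : ℝ := (1 - √(1 - 4 * a)) / 2

lemma one_sub_slowRoot_mul_slowRoot {a : ℝ} (ha : a ≤ 1 / 4) :
    (1 - slowRoot a) * slowRoot a = a := by
  have := Real.sq_sqrt (show 0 ≤ 1 - 4 * a by linarith)
  unfold slowRoot
  linarith

lemma slowRoot_nonneg {a : ℝ} (ha : 0 ≤ a) : 0 ≤ slowRoot a := by
  have := Real.sqrt_le_one.2 (show 1 - 4 * a ≤ 1 by linarith)
  unfold slowRoot
  linarith

lemma slowRoot_le {a : ℝ} (ha : a ≤ 3 / 16) : slowRoot a ≤ 1 / 4 := by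
  have : 1 / 2 ≤ √(1 - 4 * a) := Real.le_sqrt_of_sq_le (by linarith)
  unfold slowRoot
  linarith

lemma measurable_slowRoot : Measurable slowRoot := by
  unfold slowRoot
  fun_prop

section ScalarEstimates

lemma exp_neg_sq_mul_le {t : ℝ} (ht : 0 < t) (r : ℝ) :
    Real.exp (-t * r ^ 2) * (r ^ 3 * t + 3 * r) ≤ 16 / √t * Real.exp (-t * r ^ 2 / 4) := by
  set w := r * √t
  have hw2 : w ^ 2 = t * r ^ 2 := by rw [mul_pow, Real.sq_sqrt ht.le]; ring
  have hquad := Real.quadratic_le_exp_of_nonneg (show 0 ≤ 3 / 4 * w ^ 2 by positivity)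
  have hpoly : w ^ 3 + 3 * w ≤ 16 * Real.exp (3 / 4 * w ^ 2) := by
    nlinarith [sq_nonneg (w ^ 2 - w), sq_nonneg (w - 1), sq_nonneg (w ^ 2)]
  rw [div_mul_eq_mul_div, le_div_iff₀ (Real.sqrt_pos.2 ht)]
  calc Real.exp (-t * r ^ 2) * (r ^ 3 * t + 3 * r) * √t
      = Real.exp (-t * r ^ 2) * (w ^ 3 + 3 * w) := by
        rw [show w ^ 3 = w ^ 2 * w from pow_succ w 2, hw2]
        ring
    _ ≤ Real.exp (-t * r ^ 2) * (16 * Real.exp (3 / 4 * w ^ 2)) := by gcongr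
    _ = 16 * Real.exp (-t * r ^ 2 / 4) := by
        rw [mul_left_comm, ← Real.exp_add, hw2]
        ring_nf

lemma exp_neg_sq_le_of_le {r t : ℝ} (hr : 1 / 3 ≤ r) (ht : 0 < t) :
    Real.exp (-t * r ^ 2) ≤ 16 / √t * Real.exp (-t * r ^ 2 / 4) := by
  refine (le_mul_of_one_le_right (Real.exp_pos _).le ?_).trans (exp_neg_sq_mul_le ht r)
  have : 0 ≤ r ^ 3 * t := mul_nonneg (pow_nonneg (by linarith) 3) ht.le
  linarith

lemma exp_neg_div_le_rpow {c s t : ℝ} (hc : 0 < c) (hs : 0 < s) (ht : 0 < t) :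
    Real.exp (-(t / c)) ≤ (c * s) ^ s * t ^ (-s) := by
  have hbase : t / (c * s) ≤ Real.exp (t / (c * s)) :=
    (le_add_of_nonneg_right zero_le_one).trans (Real.add_one_le_exp _)
  have hpow : t ^ s / (c * s) ^ s ≤ Real.exp (t / c) :=
    calc t ^ s / (c * s) ^ s = (t / (c * s)) ^ s := (Real.div_rpow ht.le (by positivity) s).symm
      _ ≤ Real.exp (t / (c * s)) ^ s := Real.rpow_le_rpow (by positivity) hbase hs.le
      _ = Real.exp (t / c) := by
        rw [← Real.exp_mul]
        congr 1
        field_simp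
  rw [Real.exp_neg, Real.rpow_neg ht.le, ← div_eq_mul_inv, ← inv_div (t ^ s)]
  exact inv_anti₀ (by positivity) hpow

lemma exp_sub_exp_sub_le (b c : ℝ) : Real.exp b - Real.exp (b - c) ≤ Real.exp b * c := by
  have := mul_le_mul_of_nonneg_left (Real.one_sub_le_exp_neg c) (Real.exp_pos b).le
  rw [← Real.exp_add, ← sub_eq_add_neg] at this
  linarith

variable {F : Type*} [NormedAddCommGroup F] [NormedSpace ℝ F]

/-- Splitting off the slow mode: `z` is the solution at time `t` of `w'' + w' + a w = 0`,
`a = (1 - ρ) ρ`, and the two hypotheses on `z` and `z'` are the two first order factors. -/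
lemma one_sub_two_mul_norm_sub_exp_smul_le {ρ t : ℝ} (hρ0 : 0 ≤ ρ) (hρ1 : ρ ≤ 1 / 2) (ht : 0 ≤ t)
    {z z' x y P : F}
    (hslow : z' + (1 - ρ) • z = Real.exp (-t * (1 - (1 - ρ))) • (y + (1 - ρ) • x))
    (hfast : z' + ρ • z = Real.exp (-t * (1 - ρ)) • (y + ρ • x)) :
    (1 - 2 * ρ) * ‖z - Real.exp (-t * ((1 - ρ) * ρ)) • P‖ ≤
      Real.exp (-t * ((1 - ρ) * ρ)) *
        (ρ ^ 2 * t * ‖y + x‖ + ‖y + x - P‖ + 2 * ρ * ‖P‖ + ρ * ‖x‖) +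
      Real.exp (-t * (1 - ρ)) * (‖x‖ + ‖y‖) := by
  set e := Real.exp (-t * ((1 - ρ) * ρ))
  set A := Real.exp (-t * (1 - (1 - ρ)))
  set B := Real.exp (-t * (1 - ρ))
  have hAe : A ≤ e := Real.exp_le_exp.2 (by nlinarith [mul_nonneg ht (sq_nonneg ρ)])
  have heA : e - A ≤ e * (ρ ^ 2 * t) := by
    refine le_trans (le_of_eq ?_) (exp_sub_exp_sub_le (-t * ((1 - ρ) * ρ)) (ρ ^ 2 * t))
    simp only [e, A]
    ring_nf
  have hsplit : (1 - 2 * ρ) • (z - e • P) = e • (y + x - P) - (e - A) • (y + x) +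
      (2 * ρ * e) • P - (A * ρ) • x - B • (y + ρ • x) := by
    have hz : (1 - 2 * ρ) • z = A • (y + (1 - ρ) • x) - B • (y + ρ • x) := by
      rw [← hslow, ← hfast]
      module
    rw [smul_sub, hz]
    module
  have hnorm : ‖(1 - 2 * ρ) • (z - e • P)‖ ≤ e * ‖y + x - P‖ + (e - A) * ‖y + x‖ +
      2 * ρ * e * ‖P‖ + A * ρ * ‖x‖ + B * ‖y + ρ • x‖ := by
    rw [hsplit]
    refine norm_sub_le_of_le (norm_sub_le_of_le (norm_add_le_of_le (norm_sub_le_of_le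
      ?_ ?_) ?_) ?_) ?_
    all_goals exact (norm_smul_of_nonneg (by positivity) _).le
  have hxy : ‖y + ρ • x‖ ≤ ‖x‖ + ‖y‖ := by
    refine (norm_add_le _ _).trans ?_
    rw [norm_smul_of_nonneg hρ0]
    nlinarith [norm_nonneg x]
  calc (1 - 2 * ρ) * ‖z - e • P‖ = ‖(1 - 2 * ρ) • (z - e • P)‖ :=
        (norm_smul_of_nonneg (by linarith) _).symm
    _ ≤ e * ‖y + x - P‖ + e * (ρ ^ 2 * t) * ‖y + x‖ + 2 * ρ * e * ‖P‖ + e * ρ * ‖x‖ +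
        B * (‖x‖ + ‖y‖) := hnorm.trans (by gcongr)
    _ = _ := by ring

lemma norm_sub_exp_smul_le_of_slow_fast {r ρ t M : ℝ} (hr : 0 ≤ r) (hρ0 : 0 ≤ ρ) (hρ1 : ρ ≤ 1 / 4)
    (hrρ : (1 - ρ) * ρ = r ^ 2) (ht : 0 < t) {z z' x y P : F}
    (hslow : z' + (1 - ρ) • z = Real.exp (-t * (1 - (1 - ρ))) • (y + (1 - ρ) • x))
    (hfast : z' + ρ • z = Real.exp (-t * (1 - ρ)) • (y + ρ • x))
    (hx : ‖x‖ ≤ M) (hyx : ‖y + x‖ ≤ M) (hP : ‖P‖ ≤ M) (hyxP : ‖y + x - P‖ ≤ r * M) :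
    ‖z - Real.exp (-t * r ^ 2) • P‖ ≤
      32 * M / √t * Real.exp (-t * r ^ 2 / 4) + 2 * Real.exp (-(t / 30)) * (‖x‖ + ‖y‖) := by
  have hM : 0 ≤ M := (norm_nonneg x).trans hx
  have hr2 : r ≤ 1 / 2 := by nlinarith
  have hρr : 3 * ρ ≤ 2 * r := by nlinarith
  have hρr2 : ρ ^ 2 ≤ r ^ 3 := by nlinarith [pow_nonneg hr 3]
  have hsplit := one_sub_two_mul_norm_sub_exp_smul_le (P := P) hρ0 (by linarith) ht.le hslow hfast
  rw [hrρ] at hsplit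
  have hhalf : 1 / 2 * ‖z - Real.exp (-t * r ^ 2) • P‖ ≤
      (1 - 2 * ρ) * ‖z - Real.exp (-t * r ^ 2) • P‖ := by
    gcongr
    linarith
  have hmain : ρ ^ 2 * t * ‖y + x‖ + ‖y + x - P‖ + 2 * ρ * ‖P‖ + ρ * ‖x‖ ≤
      (r ^ 3 * t + 3 * r) * M :=
    calc _ ≤ r ^ 3 * t * M + r * M + 2 * ρ * M + ρ * M := by gcongr
      _ = (r ^ 3 * t + r + 3 * ρ) * M := by ring
      _ ≤ (r ^ 3 * t + 3 * r) * M := by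
        gcongr ?_ * M
        linarith
  have hexp : Real.exp (-t * r ^ 2) * ((r ^ 3 * t + 3 * r) * M) ≤
      16 * M / √t * Real.exp (-t * r ^ 2 / 4) := by
    rw [← mul_assoc]
    exact (mul_le_mul_of_nonneg_right (exp_neg_sq_mul_le ht r) hM).trans_eq (by ring)
  have hB : Real.exp (-t * (1 - ρ)) ≤ Real.exp (-(t / 30)) := Real.exp_le_exp.2 (by nlinarith)
  have hmain' := mul_le_mul_of_nonneg_left hmain (Real.exp_pos (-t * r ^ 2)).le
  have hB' : Real.exp (-t * (1 - ρ)) * (‖x‖ + ‖y‖) ≤ Real.exp (-(t / 30)) * (‖x‖ + ‖y‖) := by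
    gcongr
  calc ‖z - Real.exp (-t * r ^ 2) • P‖
      ≤ 2 * (16 * M / √t * Real.exp (-t * r ^ 2 / 4) + Real.exp (-(t / 30)) * (‖x‖ + ‖y‖)) := by
        linarith
    _ = _ := by ring

end ScalarEstimates

lemma eLpNorm_restrict_iUnion_le {α F ι : Type*} [MeasurableSpace α] {μ : Measure α}
    [NormedAddCommGroup F] [Countable ι] {f : α → F} {p c : ℝ≥0∞} (hp0 : p ≠ 0) (hp : p ≠ ⊤)
    {S : ι → Set α} (hS : Directed (· ⊆ ·) S)
    (h : ∀ k, eLpNorm f p (μ.restrict (S k)) ≤ c) :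
    eLpNorm f p (μ.restrict (⋃ k, S k)) ≤ c := by
  have hp' : 0 < p.toReal := ENNReal.toReal_pos hp0 hp
  simp only [eLpNorm_eq_lintegral_rpow_enorm_toReal hp0 hp, one_div,
    ENNReal.rpow_inv_le_iff hp'] at h ⊢
  rw [setLIntegral_iUnion_of_directed _ hS]
  exact iSup_le h

section FrequencyEstimates

variable {E : Type*} [NormedAddCommGroup E] [InnerProductSpace ℝ E] [FiniteDimensional ℝ E]
  [MeasurableSpace E] [BorelSpace E]

lemma memLp_top_laplaceSymbol {S : Set E} (hS : MeasurableSet S) {R : ℝ}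
    (hR : ∀ ξ ∈ S, laplaceSymbol ξ ≤ R) :
    MemLp laplaceSymbol ∞ (volume.restrict S : Measure E) := by
  refine memLp_top_of_bound continuous_laplaceSymbol.aestronglyMeasurable R ?_
  filter_upwards [ae_restrict_mem hS] with ξ hξ
  rw [Real.norm_of_nonneg (laplaceSymbol_nonneg ξ)]
  exact hR ξ hξ

lemma IsVeryWeakSolution.ae_eq_exp {u v : ℝ → Lp ℂ 2 (volume : Measure E)}
    (h : IsVeryWeakSolution u v) {S : Set E} (hS : IsOpen S)
    (hσ : MemLp laplaceSymbol ∞ (volume.restrict S : Measure E)) {r : E → ℝ}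
    (hr : MemLp r ∞ (volume.restrict S : Measure E))
    (hroot : ∀ ξ ∈ S, (1 - r ξ) * r ξ = laplaceSymbol ξ) {t : ℝ} (ht : 0 ≤ t) :
    ∀ᵐ ξ ∂volume.restrict S, 𝓕 (v t) ξ + r ξ • 𝓕 (u t) ξ =
      Real.exp (-t * (1 - r ξ)) • (𝓕 (v 0) ξ + r ξ • 𝓕 (u 0) ξ) := by
  filter_upwards [ae_eq_exp_of_isDampedOscillator_mulOp (h.isDampedOscillator hS hσ) hr
    (ae_restrict_of_forall_mem hS.measurableSet hroot) ht, coeFn_fourierRestrict S (u t),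
    coeFn_fourierRestrict S (v t), coeFn_fourierRestrict S (u 0), coeFn_fourierRestrict S (v 0)]
    with ξ hξ hut hvt hu0 hv0
  rwa [hut, hvt, hu0, hv0] at hξ

lemma IsVeryWeakSolution.eLpNorm_fourier_restrict_le {u v : ℝ → Lp ℂ 2 (volume : Measure E)}
    (h : IsVeryWeakSolution u v) {S : Set E} (hS : IsOpen S)
    (hσ : MemLp laplaceSymbol ∞ (volume.restrict S : Measure E))
    (hlow : ∀ ξ ∈ S, 1 / 8 ≤ laplaceSymbol ξ) {t : ℝ} (ht : 0 ≤ t) :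
    eLpNorm (𝓕 (u t) : Lp ℂ 2 (volume : Measure E)) 2 (volume.restrict S) ≤
      ENNReal.ofReal (4 * Real.exp (-(t / 30)) * (‖u 0‖ + ‖v 0‖)) := by
  have hosc := norm_le_of_isDampedOscillator_mulOp (h.isDampedOscillator hS hσ)
    (ae_restrict_of_forall_mem hS.measurableSet hlow) ht
  rw [← eLpNorm_congr_ae (coeFn_fourierRestrict S (u t)),
    ENNReal.le_ofReal_iff_toReal_le (Lp.eLpNorm_ne_top _) (by positivity), ← Lp.norm_def]
  refine hosc.trans ?_
  gcongr <;> exact norm_fourierRestrict_le S _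

lemma IsVeryWeakSolution.eLpNorm_fourier_high_le {u v : ℝ → Lp ℂ 2 (volume : Measure E)}
    (h : IsVeryWeakSolution u v) {t : ℝ} (ht : 0 ≤ t) :
    eLpNorm (𝓕 (u t) : Lp ℂ 2 (volume : Measure E)) 2
        (volume.restrict {ξ | 3 / 16 ≤ laplaceSymbol ξ}) ≤
      ENNReal.ofReal (4 * Real.exp (-(t / 30)) * (‖u 0‖ + ‖v 0‖)) := by
  let S (k : ℕ) : Set E := {ξ | 1 / 8 < laplaceSymbol ξ ∧ laplaceSymbol ξ < k}
  have hS (k : ℕ) : IsOpen (S k) := (isOpen_lt continuous_const continuous_laplaceSymbol).inter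
    (isOpen_lt continuous_laplaceSymbol continuous_const)
  have hmono : Monotone S := fun k l hkl ξ hξ => ⟨hξ.1, hξ.2.trans_le (by exact_mod_cast hkl)⟩
  have hcover : {ξ : E | 3 / 16 ≤ laplaceSymbol ξ} ⊆ ⋃ k, S k := fun ξ hξ => by
    obtain ⟨k, hk⟩ := exists_nat_gt (laplaceSymbol ξ)
    exact mem_iUnion.2 ⟨k, lt_of_lt_of_le (by norm_num) hξ, hk⟩
  refine (eLpNorm_mono_measure _ (Measure.restrict_mono_set _ hcover)).trans
    (eLpNorm_restrict_iUnion_le two_ne_zero ENNReal.ofNat_ne_top hmono.directed_le fun k => ?_)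
  exact h.eLpNorm_fourier_restrict_le (hS k)
    (memLp_top_laplaceSymbol (hS k).measurableSet fun ξ hξ => hξ.2.le) (fun ξ hξ => hξ.1.le) ht

lemma IsVeryWeakSolution.ae_low_frequency_eq {u v : ℝ → Lp ℂ 2 (volume : Measure E)}
    (h : IsVeryWeakSolution u v) {t : ℝ} (ht : 0 ≤ t) :
    ∀ᵐ ξ : E, laplaceSymbol ξ < 3 / 16 →
      𝓕 (v t) ξ + (1 - slowRoot (laplaceSymbol ξ)) • 𝓕 (u t) ξ =
        Real.exp (-t * (1 - (1 - slowRoot (laplaceSymbol ξ)))) •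
          (𝓕 (v 0) ξ + (1 - slowRoot (laplaceSymbol ξ)) • 𝓕 (u 0) ξ) ∧
      𝓕 (v t) ξ + slowRoot (laplaceSymbol ξ) • 𝓕 (u t) ξ =
        Real.exp (-t * (1 - slowRoot (laplaceSymbol ξ))) •
          (𝓕 (v 0) ξ + slowRoot (laplaceSymbol ξ) • 𝓕 (u 0) ξ) := by
  let S : Set E := {ξ | laplaceSymbol ξ < 3 / 16}
  have hS : IsOpen S := isOpen_lt continuous_laplaceSymbol continuous_const
  have hσ := memLp_top_laplaceSymbol hS.measurableSet fun ξ (hξ : ξ ∈ S) => hξ.le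
  have hr : MemLp (fun ξ => slowRoot (laplaceSymbol ξ)) ∞ (volume.restrict S : Measure E) := by
    refine memLp_top_of_bound (measurable_slowRoot.comp
      continuous_laplaceSymbol.measurable).aestronglyMeasurable (1 / 4) ?_
    filter_upwards [ae_restrict_mem hS.measurableSet] with ξ hξ
    rw [Real.norm_of_nonneg (slowRoot_nonneg (laplaceSymbol_nonneg ξ))]
    exact slowRoot_le hξ.le
  have hroot (ξ : E) (hξ : ξ ∈ S) :
      (1 - slowRoot (laplaceSymbol ξ)) * slowRoot (laplaceSymbol ξ) = laplaceSymbol ξ :=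
    one_sub_slowRoot_mul_slowRoot (hξ.le.trans (by norm_num))
  filter_upwards [(ae_restrict_iff' hS.measurableSet).1 <| h.ae_eq_exp hS hσ
      ((memLp_top_const 1).sub hr) (fun ξ hξ => by simpa [mul_comm] using hroot ξ hξ) ht,
    (ae_restrict_iff' hS.measurableSet).1 <| h.ae_eq_exp hS hσ hr hroot ht] with ξ hslow hfast hξ
  exact ⟨hslow hξ, hfast hξ⟩

end FrequencyEstimates

section WeightedL1

variable {n k : ℕ} {f : Space n → ℂ}

lemma MemWeightedL1.integral_norm_le (hf : MemWeightedL1 k f) :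
    ∫ x, ‖f x‖ ≤ weightedL1Norm k f :=
  integral_mono hf.1.norm hf.2 fun x => le_mul_of_one_le_left (norm_nonneg _)
    (one_le_pow₀ (le_add_of_nonneg_right (norm_nonneg x)))

lemma MemWeightedL1.norm_integral_le (hf : MemWeightedL1 k f) :
    ‖∫ x, f x‖ ≤ weightedL1Norm k f :=
  (norm_integral_le_integral_norm f).trans hf.integral_norm_le

lemma MemWeightedL1.norm_fourier_le (hf : MemWeightedL1 k f) (ξ : Space n) :
    ‖𝓕 f ξ‖ ≤ weightedL1Norm k f :=
  (VectorFourier.norm_fourierIntegral_le_integral_norm _ _ _ f ξ).trans hf.integral_norm_le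

lemma MemWeightedL1.norm_fourier_sub_integral_le (hf : MemWeightedL1 1 f) (ξ : Space n) :
    ‖𝓕 f ξ - ∫ x, f x‖ ≤ 2 * Real.pi * ‖ξ‖ * weightedL1Norm 1 f := by
  have hle (x : Space n) : ‖x‖ * ‖f x‖ ≤ (1 + ‖x‖) ^ 1 * ‖f x‖ := by
    rw [pow_one]
    gcongr
    linarith
  have hxf : Integrable fun x => ‖x‖ * ‖f x‖ :=
    hf.2.mono' (continuous_norm.aestronglyMeasurable.mul hf.1.aestronglyMeasurable.norm)
      (ae_of_all _ fun x => (Real.norm_of_nonneg (by positivity)).trans_le (hle x))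
  refine (DampedWave.norm_fourier_sub_integral_le hf.1 hxf ξ).trans ?_
  gcongr
  exact integral_mono hxf hf.2 hle

end WeightedL1

section DiffusionProfile

variable {n : ℕ}

lemma IsVeryWeakSolution.ae_low_frequency_le {u v : ℝ → L2 n} (h : IsVeryWeakSolution u v)
    (hu : MemWeightedL1 1 (u 0)) (hv : MemWeightedL1 1 (v 0)) {t : ℝ} (ht : 0 < t) :
    ∀ᵐ ξ : Space n, laplaceSymbol ξ < 3 / 16 →
      ‖𝓕 (u t) ξ - Real.exp (-t * laplaceSymbol ξ) • ((∫ x, u 0 x) + ∫ x, v 0 x)‖ ≤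
        32 * (weightedL1Norm 1 (u 0) + weightedL1Norm 1 (v 0)) / √t *
          Real.exp (-t * laplaceSymbol ξ / 4) +
        2 * Real.exp (-(t / 30)) * (‖𝓕 (u 0) ξ‖ + ‖𝓕 (v 0) ξ‖) := by
  have hv0 : 0 ≤ weightedL1Norm 1 (v 0) := (norm_nonneg _).trans hv.norm_integral_le
  filter_upwards [h.ae_low_frequency_eq ht.le, coeFn_fourier_of_integrable hu.1,
    coeFn_fourier_of_integrable hv.1] with ξ heq hFu hFv hξ
  obtain ⟨hslow, hfast⟩ := heq hξ
  rw [laplaceSymbol_eq_sq] at hξ ⊢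
  refine norm_sub_exp_smul_le_of_slow_fast (by positivity)
    (slowRoot_nonneg (laplaceSymbol_nonneg ξ)) (slowRoot_le ?_) ?_ ht hslow hfast ?_ ?_ ?_ ?_
  · exact (laplaceSymbol_eq_sq ξ).trans_le hξ.le
  · rw [← laplaceSymbol_eq_sq, one_sub_slowRoot_mul_slowRoot]
    rw [laplaceSymbol_eq_sq]
    linarith
  · rw [hFu]
    linarith [hu.norm_fourier_le ξ]
  · rw [hFu, hFv, add_comm]
    exact norm_add_le_of_le (hu.norm_fourier_le ξ) (hv.norm_fourier_le ξ)
  · exact norm_add_le_of_le hu.norm_integral_le hv.norm_integral_le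
  · rw [hFu, hFv, mul_add, add_comm (𝓕 (v 0 : Space n → ℂ) ξ), add_sub_add_comm]
    exact norm_add_le_of_le (hu.norm_fourier_sub_integral_le ξ) (hv.norm_fourier_sub_integral_le ξ)

lemma norm_sub_exp_smul_le_of_high {E F : Type*} [NormedAddCommGroup E] [NormedAddCommGroup F]
    [NormedSpace ℝ F] {ξ : E} (hξ : 3 / 16 ≤ laplaceSymbol ξ) {t M : ℝ} (ht : 0 < t) {P : F}
    (hP : ‖P‖ ≤ M) (z : F) :
    ‖z - Real.exp (-t * laplaceSymbol ξ) • P‖ ≤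
      32 * M / √t * Real.exp (-t * laplaceSymbol ξ / 4) + ‖z‖ := by
  have hM : 0 ≤ M := (norm_nonneg P).trans hP
  rw [laplaceSymbol_eq_sq] at hξ ⊢
  set r := 2 * Real.pi * ‖ξ‖
  have hr0 : 0 ≤ r := by positivity
  have hr : 1 / 3 ≤ r := by nlinarith
  calc ‖z - Real.exp (-t * r ^ 2) • P‖ ≤ ‖z‖ + ‖Real.exp (-t * r ^ 2) • P‖ := norm_sub_le _ _
    _ = ‖z‖ + Real.exp (-t * r ^ 2) * ‖P‖ := by rw [norm_smul_of_nonneg (Real.exp_pos _).le]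
    _ ≤ ‖z‖ + (32 / √t * Real.exp (-t * r ^ 2 / 4)) * M := by
      gcongr
      refine (exp_neg_sq_le_of_le hr ht).trans ?_
      gcongr
      norm_num
    _ = _ := by ring

lemma IsVeryWeakSolution.ae_norm_fourier_sub_le {u v : ℝ → L2 n} (h : IsVeryWeakSolution u v)
    (hu : MemWeightedL1 1 (u 0)) (hv : MemWeightedL1 1 (v 0)) {t : ℝ} (ht : 0 < t) :
    ∀ᵐ ξ : Space n,
      ‖𝓕 (u t) ξ - Real.exp (-t * laplaceSymbol ξ) • ((∫ x, u 0 x) + ∫ x, v 0 x)‖ ≤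
        32 * (weightedL1Norm 1 (u 0) + weightedL1Norm 1 (v 0)) / √t *
          Real.exp (-t * laplaceSymbol ξ / 4) +
        2 * Real.exp (-(t / 30)) * (‖𝓕 (u 0) ξ‖ + ‖𝓕 (v 0) ξ‖) +
        {ξ : Space n | 3 / 16 ≤ laplaceSymbol ξ}.indicator (fun ξ => ‖𝓕 (u t) ξ‖) ξ := by
  filter_upwards [h.ae_low_frequency_le hu hv ht] with ξ hlow
  rcases lt_or_ge (laplaceSymbol ξ) (3 / 16) with hξ | hξ
  · rw [indicator_of_notMem (by simpa using hξ), add_zero]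
    exact hlow hξ
  · rw [indicator_of_mem (show ξ ∈ {ξ | 3 / 16 ≤ laplaceSymbol ξ} from hξ)]
    refine (norm_sub_exp_smul_le_of_high hξ ht
      (norm_add_le_of_le hu.norm_integral_le hv.norm_integral_le) _).trans ?_
    gcongr
    exact le_add_of_nonneg_right (by positivity)

end DiffusionProfile

section Gaussian

variable {E : Type*} [NormedAddCommGroup E] [InnerProductSpace ℝ E] [FiniteDimensional ℝ E]
  [MeasurableSpace E] [BorelSpace E]

lemma integrable_exp_neg_mul_norm_sq {b : ℝ} (hb : 0 < b) :
    Integrable fun x : E => Real.exp (-b * ‖x‖ ^ 2) := by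
  have h := (GaussianFourier.integrable_cexp_neg_mul_sq_norm_add (b := b) (by simpa using hb) 0
    (0 : E)).norm
  refine h.congr (ae_of_all _ fun x => ?_)
  simp only [zero_mul, add_zero, ← Complex.ofReal_neg, ← Complex.ofReal_pow, ← Complex.ofReal_mul,
    Complex.norm_exp_ofReal]

lemma norm_exp_neg_mul_sq (b x : ℝ) : ‖Real.exp (-b * x)‖ ^ 2 = Real.exp (-(2 * b) * x) := by
  rw [Real.norm_of_nonneg (Real.exp_pos _).le, ← Real.exp_nat_mul]
  congr 1
  push_cast
  ring

lemma memLp_two_exp_neg_mul_norm_sq {b : ℝ} (hb : 0 < b) :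
    MemLp (fun x : E => Real.exp (-b * ‖x‖ ^ 2)) 2 volume := by
  rw [memLp_two_iff_integrable_sq_norm (integrable_exp_neg_mul_norm_sq hb).aestronglyMeasurable]
  simpa only [norm_exp_neg_mul_sq] using integrable_exp_neg_mul_norm_sq (mul_pos two_pos hb)

lemma eLpNorm_two_exp_neg_mul_norm_sq {b : ℝ} (hb : 0 < b) :
    eLpNorm (fun x : E => Real.exp (-b * ‖x‖ ^ 2)) 2 volume =
      ENNReal.ofReal ((Real.pi / (2 * b)) ^ (Module.finrank ℝ E / 4 : ℝ)) := by
  rw [(memLp_two_exp_neg_mul_norm_sq hb).eLpNorm_eq_integral_rpow_norm two_ne_zero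
    ENNReal.ofNat_ne_top]
  simp only [ENNReal.toReal_ofNat, Real.rpow_two, norm_exp_neg_mul_sq]
  rw [GaussianFourier.integral_rexp_neg_mul_sq_norm (by positivity),
    ← Real.rpow_mul (by positivity)]
  congr 2
  ring

lemma eLpNorm_exp_laplaceSymbol_le {t : ℝ} (ht : 0 < t) :
    eLpNorm (fun ξ : E => Real.exp (-t * laplaceSymbol ξ / 4)) 2 volume ≤
      ENNReal.ofReal (t ^ (-(Module.finrank ℝ E : ℝ) / 4)) := by
  have hexp (ξ : E) : -t * laplaceSymbol ξ / 4 = -(Real.pi ^ 2 * t) * ‖ξ‖ ^ 2 := by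
    rw [laplaceSymbol]
    ring
  have hle : Real.pi / (2 * (Real.pi ^ 2 * t)) ≤ t⁻¹ := by
    field_simp
    linarith [Real.pi_gt_three]
  simp only [hexp]
  rw [eLpNorm_two_exp_neg_mul_norm_sq (by positivity), neg_div, Real.rpow_neg ht.le,
    ← Real.inv_rpow ht.le]
  gcongr

lemma fourier_exp_neg_mul_norm_sq {b : ℝ} (hb : 0 < b) (ξ : E) :
    𝓕 (fun x : E => (Real.exp (-b * ‖x‖ ^ 2) : ℂ)) ξ =
      ((Real.pi / b) ^ (Module.finrank ℝ E / 2 : ℝ) *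
        Real.exp (-Real.pi ^ 2 * ‖ξ‖ ^ 2 / b) : ℝ) := by
  rw [Complex.ofReal_mul, Complex.ofReal_cpow (by positivity)]
  push_cast
  exact fourier_gaussian_innerProductSpace (by simpa using hb) ξ

end Gaussian

section GaussKernel

variable {n : ℕ} {t : ℝ}

lemma gaussKernel_eq (t : ℝ) (x : Space n) :
    gaussKernel t x = 1 / √(4 * Real.pi * t) ^ n * Real.exp (-(4 * t)⁻¹ * ‖x‖ ^ 2) := by
  rw [gaussKernel, neg_div, neg_mul, div_eq_inv_mul (‖x‖ ^ 2)]

lemma integrable_gaussKernel (ht : 0 < t) :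
    Integrable fun x : Space n => (gaussKernel t x : ℂ) := by
  simp only [gaussKernel_eq]
  exact ((integrable_exp_neg_mul_norm_sq (by positivity)).const_mul _).ofReal

lemma memLp_two_gaussKernel (ht : 0 < t) :
    MemLp (fun x : Space n => (gaussKernel t x : ℂ)) 2 volume := by
  simp only [gaussKernel_eq]
  exact ((memLp_two_exp_neg_mul_norm_sq (by positivity)).const_mul _).ofReal

lemma fourier_gaussKernel (ht : 0 < t) (ξ : Space n) :
    𝓕 (fun x : Space n => (gaussKernel t x : ℂ)) ξ = Real.exp (-t * laplaceSymbol ξ) := by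
  have hmass : (Real.pi / (4 * t)⁻¹) ^ (n / 2 : ℝ) = √(4 * Real.pi * t) ^ n := by
    rw [Real.sqrt_eq_rpow, ← Real.rpow_natCast, ← Real.rpow_mul (by positivity)]
    congr 1
    · field_simp
    · ring
  have hexp : -Real.pi ^ 2 * ‖ξ‖ ^ 2 / (4 * t)⁻¹ = -t * laplaceSymbol ξ := by
    rw [laplaceSymbol]
    field_simp
    ring
  have hscale := congrFun (VectorFourier.fourierIntegral_const_smul Real.fourierChar volume
    (innerₗ (Space n)) (fun x : Space n => (Real.exp (-(4 * t)⁻¹ * ‖x‖ ^ 2) : ℂ))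
    ((1 / √(4 * Real.pi * t) ^ n : ℝ) : ℂ)) ξ
  have hgauss := fourier_exp_neg_mul_norm_sq (inv_pos.2 (mul_pos four_pos ht)) ξ
  rw [finrank_euclideanSpace_fin, hmass, hexp] at hgauss
  simp only [gaussKernel_eq, Complex.ofReal_mul (1 / √(4 * Real.pi * t) ^ n)]
  refine hscale.trans ?_
  rw [Pi.smul_apply, smul_eq_mul]
  refine (congrArg _ hgauss).trans ?_
  rw [← Complex.ofReal_mul, ← mul_assoc, one_div_mul_cancel (by positivity), one_mul]

lemma coeFn_fourier_sub_smul_gaussKernel (ht : 0 < t) (f : L2 n) (P : ℂ) :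
    (𝓕 (f - P • (memLp_two_gaussKernel ht).toLp) : L2 n) =ᵐ[volume]
      fun ξ => 𝓕 f ξ - Real.exp (-t * laplaceSymbol ξ) • P := by
  set g : L2 n := (memLp_two_gaussKernel ht).toLp
  have hcoe : g =ᵐ[volume] fun x => (gaussKernel t x : ℂ) := (memLp_two_gaussKernel ht).coeFn_toLp
  have hintegrable : Integrable g := (integrable_gaussKernel ht).congr hcoe.symm
  rw [sub_eq_add_neg, FourierTransform.fourier_add, ← neg_smul, FourierTransform.fourier_smul]
  filter_upwards [Lp.coeFn_add (𝓕 f : L2 n) (-P • 𝓕 g), Lp.coeFn_smul (-P) (𝓕 g : L2 n),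
    coeFn_fourier_of_integrable hintegrable] with ξ hadd hsmul hg
  rw [hadd, Pi.add_apply, hsmul, Pi.smul_apply, hg, Real.fourier_congr_ae hcoe,
    fourier_gaussKernel ht, neg_smul, ← sub_eq_add_neg, smul_eq_mul, mul_comm, Complex.real_smul]

lemma eLpNorm_sub_mul_gaussKernel (ht : 0 < t) (f : L2 n) (P : ℂ) :
    eLpNorm (fun x => f x - P * gaussKernel t x) 2 volume =
      eLpNorm (fun ξ => 𝓕 f ξ - Real.exp (-t * laplaceSymbol ξ) • P) 2 volume := by
  rw [← eLpNorm_congr_ae (coeFn_fourier_sub_smul_gaussKernel ht f P), ← Lp.enorm_def,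
    ← ofReal_norm, Lp.norm_fourier_eq, ofReal_norm, Lp.enorm_def]
  refine eLpNorm_congr_ae ?_
  filter_upwards [Lp.coeFn_sub f (P • (memLp_two_gaussKernel ht).toLp),
    Lp.coeFn_smul P ((memLp_two_gaussKernel (n := n) ht).toLp),
    (memLp_two_gaussKernel (n := n) ht).coeFn_toLp] with x hsub hsmul hg
  rw [hsub, Pi.sub_apply, hsmul, Pi.smul_apply, hg, smul_eq_mul]

end GaussKernel

section DiffusionEstimate

variable {n : ℕ} {u v : ℝ → L2 n} {t : ℝ}

lemma eLpNorm_norm_fourier_add_norm_fourier_le {E : Type*} [NormedAddCommGroup E]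
    [InnerProductSpace ℝ E] [FiniteDimensional ℝ E] [MeasurableSpace E] [BorelSpace E]
    (f g : Lp ℂ 2 (volume : Measure E)) :
    eLpNorm (fun ξ => ‖𝓕 f ξ‖ + ‖𝓕 g ξ‖) 2 volume ≤ ENNReal.ofReal (‖f‖ + ‖g‖) := by
  refine (eLpNorm_add_le (Lp.aestronglyMeasurable (𝓕 f)).norm (Lp.aestronglyMeasurable (𝓕 g)).norm
    one_le_two).trans_eq ?_
  rw [eLpNorm_norm, eLpNorm_norm, ← Lp.enorm_def, ← Lp.enorm_def, ← ofReal_norm, ← ofReal_norm,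
    Lp.norm_fourier_eq, Lp.norm_fourier_eq, ENNReal.ofReal_add (norm_nonneg _) (norm_nonneg _)]

lemma eLpNorm_const_mul_le {α : Type*} [MeasurableSpace α] {μ : Measure α} {p : ℝ≥0∞} {f : α → ℝ}
    {b c : ℝ} (hc : 0 ≤ c) (hf : eLpNorm f p μ ≤ ENNReal.ofReal b) :
    eLpNorm (fun x => c * f x) p μ ≤ ENNReal.ofReal (c * b) := by
  refine (eLpNorm_const_smul c f p μ).trans_le ?_
  rw [Real.enorm_of_nonneg hc, ENNReal.ofReal_mul hc]
  gcongr

lemma eLpNorm_le_ofReal_add_add {α F : Type*} [MeasurableSpace α] {μ : Measure α}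
    [NormedAddCommGroup F] {p : ℝ≥0∞} (hp : 1 ≤ p) {f : α → F} {g₁ g₂ g₃ : α → ℝ} {c₁ c₂ c₃ : ℝ}
    (hg₁ : AEStronglyMeasurable g₁ μ) (hg₂ : AEStronglyMeasurable g₂ μ)
    (hg₃ : AEStronglyMeasurable g₃ μ) (hc₁ : 0 ≤ c₁) (hc₂ : 0 ≤ c₂) (hc₃ : 0 ≤ c₃)
    (hf : ∀ᵐ x ∂μ, ‖f x‖ ≤ g₁ x + g₂ x + g₃ x) (h₁ : eLpNorm g₁ p μ ≤ ENNReal.ofReal c₁)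
    (h₂ : eLpNorm g₂ p μ ≤ ENNReal.ofReal c₂) (h₃ : eLpNorm g₃ p μ ≤ ENNReal.ofReal c₃) :
    eLpNorm f p μ ≤ ENNReal.ofReal (c₁ + c₂ + c₃) := by
  rw [ENNReal.ofReal_add (by positivity) hc₃, ENNReal.ofReal_add hc₁ hc₂]
  exact (eLpNorm_mono_ae_real hf).trans <| (eLpNorm_add_le (hg₁.add hg₂) hg₃ hp).trans <|
    add_le_add ((eLpNorm_add_le hg₁ hg₂ hp).trans (add_le_add h₁ h₂)) h₃

lemma IsVeryWeakSolution.eLpNorm_sub_gaussKernel_le (h : IsVeryWeakSolution u v)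
    (hu : MemWeightedL1 1 (u 0)) (hv : MemWeightedL1 1 (v 0)) (ht : 0 < t) :
    eLpNorm (fun x => u t x - ((∫ y, u 0 y) + ∫ y, v 0 y) * gaussKernel t x) 2 volume ≤
      ENNReal.ofReal (32 * (weightedL1Norm 1 (u 0) + weightedL1Norm 1 (v 0)) / √t *
          t ^ (-(n : ℝ) / 4) + 6 * Real.exp (-(t / 30)) * (‖u 0‖ + ‖v 0‖)) := by
  have hM : 0 ≤ weightedL1Norm 1 (u 0) + weightedL1Norm 1 (v 0) :=
    (norm_nonneg _).trans (norm_add_le_of_le hu.norm_integral_le hv.norm_integral_le)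
  set M := weightedL1Norm 1 (u 0) + weightedL1Norm 1 (v 0)
  let S : Set (Space n) := {ξ | 3 / 16 ≤ laplaceSymbol ξ}
  have hS : MeasurableSet S := (isClosed_le continuous_const continuous_laplaceSymbol).measurableSet
  let diffusive (ξ : Space n) : ℝ := 32 * M / √t * Real.exp (-t * laplaceSymbol ξ / 4)
  let initial (ξ : Space n) : ℝ := 2 * Real.exp (-(t / 30)) * (‖𝓕 (u 0) ξ‖ + ‖𝓕 (v 0) ξ‖)
  let high : Space n → ℝ := S.indicator fun ξ => ‖𝓕 (u t) ξ‖
  have hdiffusive : eLpNorm diffusive 2 volume ≤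
      ENNReal.ofReal (32 * M / √t * t ^ (-(n : ℝ) / 4)) :=
    eLpNorm_const_mul_le (by positivity)
      (by simpa using eLpNorm_exp_laplaceSymbol_le (E := Space n) ht)
  have hinitial : eLpNorm initial 2 volume ≤
      ENNReal.ofReal (2 * Real.exp (-(t / 30)) * (‖u 0‖ + ‖v 0‖)) :=
    eLpNorm_const_mul_le (by positivity) (eLpNorm_norm_fourier_add_norm_fourier_le _ _)
  have hhigh : eLpNorm high 2 volume ≤
      ENNReal.ofReal (4 * Real.exp (-(t / 30)) * (‖u 0‖ + ‖v 0‖)) := by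
    rw [eLpNorm_indicator_eq_eLpNorm_restrict hS, eLpNorm_norm]
    exact h.eLpNorm_fourier_high_le ht.le
  have hdiffusive_meas : AEStronglyMeasurable diffusive volume := by
    have := continuous_laplaceSymbol (E := Space n)
    exact Continuous.aestronglyMeasurable (by fun_prop)
  have hinitial_meas : AEStronglyMeasurable initial volume :=
    ((Lp.aestronglyMeasurable (𝓕 (u 0))).norm.add
      (Lp.aestronglyMeasurable (𝓕 (v 0))).norm).const_mul _
  have hhigh_meas : AEStronglyMeasurable high volume :=
    (Lp.aestronglyMeasurable (𝓕 (u t))).norm.indicator hS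
  rw [eLpNorm_sub_mul_gaussKernel ht]
  refine (eLpNorm_le_ofReal_add_add one_le_two hdiffusive_meas hinitial_meas hhigh_meas
    (by positivity) (by positivity) (by positivity) (h.ae_norm_fourier_sub_le hu hv ht)
    hdiffusive hinitial hhigh).trans_eq ?_
  congr 1
  ring

end DiffusionEstimate

section WeakSolution

variable {n : ℕ}

lemma partialDeriv_eq_lineDerivOp (j : Fin n) (φ : 𝓢(Space n, ℂ)) (x : Space n) :
    partialDeriv j φ x = LineDeriv.lineDerivOp (EuclideanSpace.single j (1 : ℝ)) φ x := by
  rw [SchwartzMap.lineDerivOp_apply_eq_fderiv, partialDeriv]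

lemma IsWeakGradient.integral_sum_mul_partialDeriv {f : L2 n} {g : L2Vec n}
    (h : IsWeakGradient f g) (φ : 𝓢(Space n, ℂ)) :
    ∫ x, ∑ j : Fin n, g x j * partialDeriv j φ x = -∫ x, f x * (Δ φ) x := by
  have hg (j : Fin n) : MemLp (fun x => g x j) 2 volume :=
    (EuclideanSpace.proj (𝕜 := ℂ) j).comp_memLp' (Lp.memLp g)
  let D (j : Fin n) : 𝓢(Space n, ℂ) := LineDeriv.lineDerivOp (EuclideanSpace.single j (1 : ℝ)) φ
  have hD (j : Fin n) (x : Space n) : partialDeriv j φ x = D j x :=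
    partialDeriv_eq_lineDerivOp j φ x
  have hΔ (x : Space n) : (Δ φ) x = ∑ j, partialDeriv j (D j) x := by
    simp only [SchwartzMap.laplacian_eq_sum (EuclideanSpace.basisFun (Fin n) ℝ),
      EuclideanSpace.basisFun_apply, sum_apply, partialDeriv_eq_lineDerivOp, D]
  have hfD (j : Fin n) : Integrable fun x => f x * partialDeriv j (D j) x := by
    simp only [partialDeriv_eq_lineDerivOp]
    exact (Lp.memLp f).integrable_mul (SchwartzMap.memLp _ 2 volume)
  have hgD (j : Fin n) : Integrable fun x => g x j * D j x :=
    (hg j).integrable_mul (SchwartzMap.memLp _ 2 volume)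
  simp only [hΔ, hD, Finset.mul_sum]
  rw [integral_finsetSum _ fun j _ => hgD j, integral_finsetSum _ fun j _ => hfD j,
    ← Finset.sum_neg_distrib]
  exact Finset.sum_congr rfl fun j _ => by rw [h j (D j), neg_neg]

lemma IsWeakSolution.exists_isVeryWeakSolution {u₀ : H1 n} {u₁ : L2 n} {u : ℝ → H1 n}
    (h : IsWeakSolution u₀ u₁ u) :
    (u 0).toL2 = u₀.toL2 ∧ ∃ v, v 0 = u₁ ∧ IsVeryWeakSolution (fun t => (u t).toL2) v := by
  obtain ⟨-, rfl, v, hv, hderiv, rfl, heq⟩ := h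
  refine ⟨rfl, v, rfl, hv, hderiv, fun φ t ht => ?_⟩
  have hgrad : IsWeakGradient (u t).toL2 (u t).grad := (u t).2
  have hφ := heq φ t ht
  rwa [hgrad.integral_sum_mul_partialDeriv φ, neg_neg] at hφ

end WeakSolution

end DampedWave

end

open DampedWave in
theorem theorem1p2_general (n : ℕ) :
    ∃ C : ℝ, 0 < C ∧ ∀ u v : ℝ → L2 n, IsVeryWeakSolution u v →
      MemWeightedL1 1 (u 0) → MemWeightedL1 1 (v 0) → ∀ t : ℝ, 0 < t →
        eLpNorm (fun x => u t x - ((∫ y, u 0 y) + ∫ y, v 0 y) * gaussKernel t x) 2 volume ≤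
          ENNReal.ofReal (C * t ^ (-(n : ℝ) / 4 - 1 / 2) *
            (weightedL1Norm 1 (u 0) + weightedL1Norm 1 (v 0) + ‖u 0‖ + ‖v 0‖)) := by
  set s : ℝ := n / 4 + 1 / 2 with hs
  have hrate (t : ℝ) : t ^ (-(n : ℝ) / 4 - 1 / 2) = t ^ (-s) := by
    rw [hs, neg_add, neg_div, sub_eq_add_neg]
  refine ⟨32 + 6 * (30 * s) ^ s, by positivity, fun u v h hu hv t ht => ?_⟩
  refine (h.eLpNorm_sub_gaussKernel_le hu hv ht).trans (ENNReal.ofReal_le_ofReal ?_)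
  have hM : 0 ≤ weightedL1Norm 1 (u 0) + weightedL1Norm 1 (v 0) :=
    (norm_nonneg _).trans (norm_add_le_of_le hu.norm_integral_le hv.norm_integral_le)
  set M := weightedL1Norm 1 (u 0) + weightedL1Norm 1 (v 0)
  have hsqrt : t ^ (-(n : ℝ) / 4) / √t = t ^ (-s) := by
    rw [← hrate, Real.rpow_sub ht, Real.sqrt_eq_rpow]
  calc 32 * M / √t * t ^ (-(n : ℝ) / 4) + 6 * Real.exp (-(t / 30)) * (‖u 0‖ + ‖v 0‖)
      = 32 * M * t ^ (-s) + 6 * Real.exp (-(t / 30)) * (‖u 0‖ + ‖v 0‖) := by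
        rw [← hsqrt]
        ring
    _ ≤ 32 * M * t ^ (-s) + 6 * ((30 * s) ^ s * t ^ (-s)) * (‖u 0‖ + ‖v 0‖) := by
        gcongr
        exact exp_neg_div_le_rpow (by norm_num) (by positivity) ht
    _ ≤ (32 + 6 * (30 * s) ^ s) * t ^ (-(n : ℝ) / 4 - 1 / 2) * (M + ‖u 0‖ + ‖v 0‖) := by
        rw [hrate]
        have : 0 ≤ (30 * s) ^ s * t ^ (-s) * M := by positivity
        have : 0 ≤ t ^ (-s) * (‖u 0‖ + ‖v 0‖) := by positivity
        linarith

theorem theorem1p2 (n : ℕ) (hn : 1 ≤ n) :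
    ∃ C : ℝ, 0 < C ∧
      ∀ (u₀ : DampedWave.H1 n) (u₁ : DampedWave.L2 n),
        DampedWave.MemWeightedL1 1 u₀.toL2 → DampedWave.MemWeightedL1 1 u₁ →
        ∀ u : ℝ → DampedWave.H1 n, DampedWave.IsWeakSolution u₀ u₁ u →
        ∀ t : ℝ, 0 < t →
          eLpNorm (fun x : DampedWave.Space n =>
              (u t).toL2 x - ((∫ y, u₀.toL2 y) + ∫ y, u₁ y) * (DampedWave.gaussKernel t x : ℂ))
            2 volume ≤
          ENNReal.ofReal (C * t ^ (-(n : ℝ) / 4 - 1 / 2) *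
            (DampedWave.weightedL1Norm 1 u₀.toL2 + DampedWave.weightedL1Norm 1 u₁ +
              ‖u₀.toL2‖ + ‖u₀.grad‖ + ‖u₁‖)) := by
  obtain ⟨C, hC, hdiff⟩ := theorem1p2_general n
  refine ⟨C, hC, fun u₀ u₁ hu₀ hu₁ u hu t ht => ?_⟩
  obtain ⟨hu0, v, rfl, huv⟩ := hu.exists_isVeryWeakSolution
  rw [← hu0] at hu₀ ⊢
  refine (hdiff _ v huv hu₀ hu₁ t ht).trans (ENNReal.ofReal_le_ofReal ?_)
  exact mul_le_mul_of_nonneg_left (by linarith [norm_nonneg u₀.grad]) (by positivity)
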